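/- Let $d\ge 1$ and let $D,L\subset\mathbb R^d$ be compact. Write $g_{D,L}(z)=\mathrm{Vol}(D\cap(L+z))$ for $z\in\mathbb R^d$ (Vol is Lebesgue measure), $g_D=g_{D,D}$, and $h(D-L)=\sup_{x\in D,\,y\in L}|x-y|$ (with $\sup\emptyset=0$), where $|\cdot|$ is the Euclidean norm. The perimeter of $D$ is $$\mathrm{Per}(D)=\sup\Big\{\int_D \operatorname{div}\varphi\,dx:\ \varphi\in C^1_c(\mathbb R^d,\mathbb R^d),\ |\varphi(x)|\le 1\ \text{for all }x\Big\}\in[0,\infty].$$ Then: (i) $g_{D,L}(z)=g_{L,D}(-z)$ for all $z\in\mathbb R^d$; in particular $g_D(z)=g_D(-z)$. (ii) For all $z,h\in\mathbb R^d$, $|g_{D,L}(z+h)-g_{D,L}(z)|\le 2\min\{g_D(0)-g_D(h),\ g_L(0)-g_L(h)\}$. (iii) $g_{D,L}(z)=0$ whenever $|z|>h(D-L)$. (iv) $\mathrm{Per}(D)<\infty$ if and only if $g_D$ is Lipschitz continuous, and in that case $|g_D(x)-g_D(y)|\le\frac12\mathrm{Per}(D)\,|x-y|$ for all $x,y\in\mathbb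 R^d$. (v) Suppose $\mathrm{Per}(D)<\infty$ or $\mathrm{Per}(L)<\infty$, and put $M=\min\{\mathrm{Per}(D),\mathrm{Per}(L)\}$. Then $|g_{D,L}(x)-g_{D,L}(y)|\le M|x-y|$ for all $x,y\in\mathbb R^d$. For almost every $z\in\mathbb R^d$, the directional derivatives of $g_{D,L}$ at $z$ in all directions $\theta\in S^{d-1}$ exist and are bounded by $M$ in absolute value. Moreover, for every $\theta\in S^{d-1}$, the derivative $\frac{d}{dl}g_{D,L}(l\theta)$ exists for almost every $l\in\mathbb R$, is bounded by $M$ in absolute value, and is integrable on $(0,\infty)$; the function $r\mapsto g_{D,L}(r\theta)$ is absolutely continuous on every compact interval of $\mathbb R$; and $$g_{D,L}(r\theta)=\int_r^{h(D-L)}\Big(-\frac{d}{dl}g_{D,L}(l\theta)\Big)\,dl\qquad\text{for all } r>0,$$ where for $r>h(D-L)$ the integral is understood as $-\int_{h(D-L)}^r$. -/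

import Mathlib

open MeasureTheory Set
open scoped ENNReal NNReal

/-- The divergence `∑ᵢ ∂ᵢ φᵢ` of a vector field on `ℝ^d`. -/
noncomputable def divergence {d : ℕ}
    (φ : EuclideanSpace ℝ (Fin d) → EuclideanSpace ℝ (Fin d))
    (x : EuclideanSpace ℝ (Fin d)) : ℝ :=
  ∑ i : Fin d, (fderiv ℝ φ x (EuclideanSpace.single i 1)) i

/-- The perimeter (in the sense of Caccioppoli and De Giorgi), the total variation of the
indicator of `A`: the supremum of `∫_A div φ` over all compactly supported `C¹` vector fields
`φ` with `|φ| ≤ 1` pointwise. Since `φ = 0` is admissible, truncating the integrals at zero by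
`ENNReal.ofReal` does not change the supremum. -/
noncomputable def perimeter {d : ℕ} (A : Set (EuclideanSpace ℝ (Fin d))) : ℝ≥0∞ :=
  ⨆ (φ : EuclideanSpace ℝ (Fin d) → EuclideanSpace ℝ (Fin d))
    (_ : ContDiff ℝ 1 φ) (_ : HasCompactSupport φ) (_ : ∀ x, ‖φ x‖ ≤ 1),
    ENNReal.ofReal (∫ x in A, divergence φ x)

/-- The cross covariogram `g_{D,L}(z) = Vol(D ∩ (L + z))`. -/
noncomputable def crossCovariogram {d : ℕ} (D L : Set (EuclideanSpace ℝ (Fin d)))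
    (z : EuclideanSpace ℝ (Fin d)) : ℝ :=
  volume.real (D ∩ (fun y => y + z) '' L)

/-- The covariogram `g_D = g_{D,D}`. -/
noncomputable def covariogram {d : ℕ} (D : Set (EuclideanSpace ℝ (Fin d)))
    (z : EuclideanSpace ℝ (Fin d)) : ℝ :=
  crossCovariogram D D z

/-- `h(D - L) = sup {|x - y| : x ∈ D, y ∈ L}`; a finite supremum for bounded `D`, `L`, and `0`
if one of the sets is empty. -/
noncomputable def diffRadius {d : ℕ} (D L : Set (EuclideanSpace ℝ (Fin d))) : ℝ :=
  sSup (image2 (fun x y => ‖x - y‖) D L)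

/-! Everything rests on the increment `w_K(h) = g_K(0) - g_K(h)`, the volume of `K \ (K + h)` and
also of `(K + h) \ K`. With `K = D` or `K = L` it bounds the increments of `g_{D,L}`. Duality links
it to the perimeter: for a test function `ψ`, `∫_K ψ(x + v) - ψ(x) dx` is the integral of `ψ` over
`(K + v) \ K` minus that over `K \ (K + v)`. Integrating `∂_v ψ` along the segment bounds it by
`Per(K)|v|`, and `ψ` close to `1` and `-1` on the two pieces gives `2 w_K(v) ≤ Per(K)|v|`
(`covariogram_zero_sub_le`). Conversely it is at most `2 w_K(v)`, so a Lipschitz `g_K` bounds `∫_K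
∂_v ψ`, hence the perimeter (`perimeter_lt_top_of_lipschitzWith`). The derivative claims follow from
Rademacher's theorem and absolute continuity along lines. -/

section CovariogramMeasure

/-! ### Covariograms and volumes of translates -/

variable {d : ℕ}

theorem image_add_right_eq_preimage_sub (L : Set (EuclideanSpace ℝ (Fin d)))
    (z : EuclideanSpace ℝ (Fin d)) :
    (fun y => y + z) '' L = (fun y => y - z) ⁻¹' L := by
  ext x
  constructor
  · rintro ⟨y, hy, rfl⟩
    simpa using hy
  · intro hx
    exact ⟨x - z, hx, by simp⟩

theorem volume_real_image_add_right (L : Set (EuclideanSpace ℝ (Fin d)))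
    (z : EuclideanSpace ℝ (Fin d)) :
    volume.real ((fun y => y + z) '' L) = volume.real L := by
  simp [Measure.real]

theorem IsCompact.image_add_right {L : Set (EuclideanSpace ℝ (Fin d))} (hL : IsCompact L)
    (z : EuclideanSpace ℝ (Fin d)) : IsCompact ((fun y => y + z) '' L) :=
  hL.image (by fun_prop)

theorem image_add_right_add (L : Set (EuclideanSpace ℝ (Fin d)))
    (z h : EuclideanSpace ℝ (Fin d)) :
    (fun y => y + (z + h)) '' L = (fun y => y + z) '' ((fun y => y + h) '' L) := by
  rw [image_image]
  congr 1
  ext y : 1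
  abel

theorem crossCovariogram_neg (D L : Set (EuclideanSpace ℝ (Fin d)))
    (z : EuclideanSpace ℝ (Fin d)) : crossCovariogram D L z = crossCovariogram L D (-z) := by
  unfold crossCovariogram
  rw [← volume_real_image_add_right (D ∩ (fun y => y + z) '' L) (-z),
    image_inter (add_left_injective (-z)), image_image]
  simp [inter_comm]

theorem covariogram_neg (D : Set (EuclideanSpace ℝ (Fin d))) (z : EuclideanSpace ℝ (Fin d)) :
    covariogram D (-z) = covariogram D z :=
  (crossCovariogram_neg D D z).symm

theorem volume_real_sdiff_translate {L : Set (EuclideanSpace ℝ (Fin d))} (hL : IsCompact L)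
    (h : EuclideanSpace ℝ (Fin d)) :
    volume.real (L \ (fun y => y + h) '' L) = covariogram L 0 - covariogram L h := by
  have := measureReal_inter_add_sdiff (μ := volume) (s := L) (hL.image_add_right h).measurableSet
    hL.measure_lt_top.ne
  simp only [covariogram, crossCovariogram, add_zero, image_id', inter_self]
  linarith

theorem volume_real_translate_sdiff {L : Set (EuclideanSpace ℝ (Fin d))} (hL : IsCompact L)
    (h : EuclideanSpace ℝ (Fin d)) :
    volume.real ((fun y => y + h) '' L \ L) = covariogram L 0 - covariogram L h := by
  have := measureReal_inter_add_sdiff (μ := volume) (s := (fun y => y + h) '' L) hL.measurableSet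
    (hL.image_add_right h).measure_lt_top.ne
  rw [volume_real_image_add_right, inter_comm] at this
  simp only [covariogram, crossCovariogram, add_zero, image_id', inter_self]
  linarith

theorem abs_crossCovariogram_add_sub_le_right (D : Set (EuclideanSpace ℝ (Fin d)))
    {L : Set (EuclideanSpace ℝ (Fin d))} (hL : IsCompact L) (z h : EuclideanSpace ℝ (Fin d)) :
    |crossCovariogram D L (z + h) - crossCovariogram D L z| ≤
      covariogram L 0 - covariogram L h := by
  have key : ∀ A B : Set (EuclideanSpace ℝ (Fin d)), IsCompact A → IsCompact B →
      volume.real (D ∩ A) ≤ volume.real (D ∩ B) + volume.real (A \ B) := by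
    intro A B hA hB
    have hfin : volume ((D ∩ B) ∪ (A \ B)) ≠ ∞ :=
      ((measure_mono (t := B ∪ A)
        (union_subset_union inter_subset_right sdiff_subset)).trans_lt
          (hB.union hA).measure_lt_top).ne
    refine (measureReal_mono (s₂ := (D ∩ B) ∪ (A \ B)) ?_ hfin).trans (measureReal_union_le _ _)
    intro x hx
    by_cases hxB : x ∈ B
    · exact Or.inl ⟨hx.1, hxB⟩
    · exact Or.inr ⟨hx.2, hxB⟩
  have hi := add_left_injective z
  have h1 := key _ _ (hL.image_add_right (z + h)) (hL.image_add_right z)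
  have h2 := key _ _ (hL.image_add_right z) (hL.image_add_right (z + h))
  -- Undoing the common translation by `z` leaves a difference of `L` and `L + h`.
  rw [image_add_right_add, ← image_sdiff hi, volume_real_image_add_right,
    volume_real_translate_sdiff hL, ← image_add_right_add] at h1
  rw [image_add_right_add, ← image_sdiff hi, volume_real_image_add_right,
    volume_real_sdiff_translate hL, ← image_add_right_add] at h2
  unfold crossCovariogram
  rw [abs_le]
  constructor <;> linarith

theorem abs_crossCovariogram_add_sub_le_left {D : Set (EuclideanSpace ℝ (Fin d))}
    (hD : IsCompact D) (L : Set (EuclideanSpace ℝ (Fin d))) (z h : EuclideanSpace ℝ (Fin d)) :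
    |crossCovariogram D L (z + h) - crossCovariogram D L z| ≤
      covariogram D 0 - covariogram D h := by
  rw [crossCovariogram_neg D L, crossCovariogram_neg D L, neg_add, ← covariogram_neg D h]
  exact abs_crossCovariogram_add_sub_le_right L hD (-z) (-h)

theorem lipschitzWith_of_abs_add_sub_le {g : EuclideanSpace ℝ (Fin d) → ℝ}
    {w : EuclideanSpace ℝ (Fin d) → ℝ} {C : ℝ≥0} (hg : ∀ z h, |g (z + h) - g z| ≤ w h)
    (hw : ∀ h, w h ≤ C * ‖h‖) : LipschitzWith C g := by
  refine LipschitzWith.of_dist_le_mul fun x y => ?_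
  have := (hg y (x - y)).trans (hw (x - y))
  rwa [add_sub_cancel, ← Real.dist_eq, ← dist_eq_norm] at this

theorem crossCovariogram_eq_zero_of_diffRadius_lt {D L : Set (EuclideanSpace ℝ (Fin d))}
    (hD : IsCompact D) (hL : IsCompact L) {z : EuclideanSpace ℝ (Fin d)}
    (hz : diffRadius D L < ‖z‖) : crossCovariogram D L z = 0 := by
  have hbdd : BddAbove (image2 (fun x y => ‖x - y‖) D L) := by
    rw [← image_prod]
    exact ((hD.prod hL).image (by fun_prop)).bddAbove
  have : D ∩ (fun y => y + z) '' L = ∅ := by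
    rw [eq_empty_iff_forall_notMem]
    rintro _ ⟨hx, y, hy, rfl⟩
    have := le_csSup hbdd (mem_image2_of_mem hx hy)
    simp only [add_sub_cancel_left] at this
    exact absurd this (not_le.2 hz)
  rw [crossCovariogram, this, measureReal_empty]

theorem diffRadius_nonneg (D L : Set (EuclideanSpace ℝ (Fin d))) : 0 ≤ diffRadius D L := by
  apply Real.sSup_nonneg
  rintro _ ⟨x, _, y, _, rfl⟩
  exact norm_nonneg _

end CovariogramMeasure

/-! ### Perimeter and Lipschitz bounds -/

section Perimeter

variable {d : ℕ}

theorem setIntegral_divergence_le_perimeter {A : Set (EuclideanSpace ℝ (Fin d))}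
    (hA : perimeter A < ∞) {φ : EuclideanSpace ℝ (Fin d) → EuclideanSpace ℝ (Fin d)}
    (hφ : ContDiff ℝ 1 φ) (hc : HasCompactSupport φ) (hb : ∀ x, ‖φ x‖ ≤ 1) :
    ∫ x in A, divergence φ x ≤ (perimeter A).toReal := by
  rw [← ENNReal.ofReal_le_iff_le_toReal hA.ne]
  unfold perimeter
  exact le_iSup₂_of_le φ hφ (le_iSup₂_of_le hc hb le_rfl)

theorem divergence_smul_const {ψ : EuclideanSpace ℝ (Fin d) → ℝ}
    {x : EuclideanSpace ℝ (Fin d)} (hψ : DifferentiableAt ℝ ψ x)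
    (v : EuclideanSpace ℝ (Fin d)) :
    divergence (fun y => ψ y • v) x = fderiv ℝ ψ x v := by
  unfold divergence
  rw [fderiv_smul_const hψ]
  have hv : v = ∑ i, v i • EuclideanSpace.single i (1 : ℝ) := by
    ext j
    simp [Finset.sum_apply, Pi.single_apply]
  conv_rhs => rw [hv, map_sum]
  refine Finset.sum_congr rfl fun i _ => ?_
  simp [mul_comm]

theorem hasDerivAt_setIntegral_comp_add_smul {K : Set (EuclideanSpace ℝ (Fin d))}
    (hK : IsCompact K) {ψ : EuclideanSpace ℝ (Fin d) → ℝ} (hψ : ContDiff ℝ 1 ψ)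
    (hc : HasCompactSupport ψ) (v : EuclideanSpace ℝ (Fin d)) (t : ℝ) :
    HasDerivAt (fun s : ℝ => ∫ x in K, ψ (x + s • v))
      (∫ x in K, fderiv ℝ ψ (x + t • v) v) t := by
  have hcont : Continuous (fderiv ℝ ψ) := hψ.continuous_fderiv one_ne_zero
  obtain ⟨C, hC⟩ := (hc.fderiv (𝕜 := ℝ)).exists_bound_of_continuous hcont
  have hψc := hψ.continuous
  refine (hasDerivAt_integral_of_dominated_loc_of_deriv_le (bound := fun _ => C * ‖v‖)
    (F := fun (s : ℝ) x => ψ (x + s • v)) (F' := fun (s : ℝ) x => fderiv ℝ ψ (x + s • v) v)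
    Filter.univ_mem ?_ ?_ ?_ ?_ ?_ ?_).2
  · exact Filter.Eventually.of_forall fun s =>
      (Continuous.aestronglyMeasurable (by fun_prop))
  · exact (Continuous.continuousOn (by fun_prop)).integrableOn_compact hK
  · exact Continuous.aestronglyMeasurable (by fun_prop)
  · exact Filter.Eventually.of_forall fun x s _ => (fderiv ℝ ψ (x + s • v)).le_of_opNorm_le (hC _) v
  · exact continuousOn_const.integrableOn_compact hK
  · refine Filter.Eventually.of_forall fun x s _ => ?_
    have h1 : HasDerivAt (fun s : ℝ => x + s • v) v s := by
      simpa using ((hasDerivAt_id s).smul_const v).const_add x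
    exact ((hψ.differentiable one_ne_zero _).hasFDerivAt).comp_hasDerivAt s h1

/-- After a change of variables, the contribution of `K ∩ (K + v)` cancels. -/
theorem setIntegral_comp_add_sub {K : Set (EuclideanSpace ℝ (Fin d))}
    (hK : IsCompact K) {ψ : EuclideanSpace ℝ (Fin d) → ℝ} (hψ : Continuous ψ)
    (v : EuclideanSpace ℝ (Fin d)) :
    (∫ x in K, ψ (x + v)) - ∫ x in K, ψ x =
      (∫ x in (fun y => y + v) '' K \ K, ψ x) - ∫ x in K \ (fun y => y + v) '' K, ψ x := by
  have hT := hK.image_add_right v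
  have h0 : ∫ x in K, ψ (x + v) = ∫ x in (fun y => y + v) '' K, ψ x :=
    ((measurePreserving_add_right volume v).setIntegral_image_emb
      (measurableEmbedding_addRight v) ψ K).symm
  have h1 := integral_inter_add_sdiff hT.measurableSet
    (hψ.continuousOn.integrableOn_compact (μ := volume) hK)
  have h2 := integral_inter_add_sdiff hK.measurableSet
    (hψ.continuousOn.integrableOn_compact (μ := volume) hT)
  rw [inter_comm] at h2
  rw [h0]
  linarith

theorem abs_setIntegral_comp_add_sub_le {K : Set (EuclideanSpace ℝ (Fin d))}
    (hK : IsCompact K) {ψ : EuclideanSpace ℝ (Fin d) → ℝ} (hψ : Continuous ψ)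
    (hb : ∀ x, |ψ x| ≤ 1) (v : EuclideanSpace ℝ (Fin d)) :
    |(∫ x in K, ψ (x + v)) - ∫ x in K, ψ x| ≤ 2 * (covariogram K 0 - covariogram K v) := by
  have hT := hK.image_add_right v
  have key : ∀ S T : Set (EuclideanSpace ℝ (Fin d)), IsCompact S →
      |∫ x in S \ T, ψ x| ≤ volume.real (S \ T) := by
    intro S T hS
    have := norm_setIntegral_le_of_norm_le_const (f := ψ) (C := 1) (s := S \ T)
      ((measure_mono sdiff_subset).trans_lt (hS.measure_lt_top (μ := volume))) (fun x _ => hb x)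
    simpa using this
  rw [setIntegral_comp_add_sub hK hψ]
  have h1 := key _ K hT
  have h2 := key K ((fun y => y + v) '' K) hK
  rw [volume_real_translate_sdiff hK] at h1
  rw [volume_real_sdiff_translate hK] at h2
  have := abs_sub (∫ x in (fun y => y + v) '' K \ K, ψ x)
    (∫ x in K \ (fun y => y + v) '' K, ψ x)
  linarith

theorem setIntegral_comp_add_sub_le_perimeter {K : Set (EuclideanSpace ℝ (Fin d))}
    (hK : IsCompact K) (hP : perimeter K < ∞) {ψ : EuclideanSpace ℝ (Fin d) → ℝ}
    (hψ : ContDiff ℝ 1 ψ) (hc : HasCompactSupport ψ) (hb : ∀ x, |ψ x| ≤ 1)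
    (v : EuclideanSpace ℝ (Fin d)) :
    (∫ x in K, ψ (x + v)) - ∫ x in K, ψ x ≤ (perimeter K).toReal * ‖v‖ := by
  rcases eq_or_ne v 0 with rfl | hv
  · simp
  have hd := hasDerivAt_setIntegral_comp_add_smul hK hψ hc v
  have hbound : ∀ t : ℝ, ∫ x in K, fderiv ℝ ψ (x + t • v) v ≤ (perimeter K).toReal * ‖v‖ := by
    intro t
    have hv' : 0 < ‖v‖ := norm_pos_iff.2 hv
    have hψt : ContDiff ℝ 1 (fun x => ψ (x + t • v)) := by fun_prop
    have hdiv : ∀ x, divergence (fun y => ψ (y + t • v) • (‖v‖⁻¹ • v)) x =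
        ‖v‖⁻¹ * fderiv ℝ ψ (x + t • v) v := by
      intro x
      rw [divergence_smul_const (hψt.differentiable one_ne_zero x), fderiv_comp_add_right,
        map_smul, smul_eq_mul]
    -- The field `ψ(· + tv) v/|v|` is admissible in the definition of the perimeter.
    have h := setIntegral_divergence_le_perimeter hP
      (φ := fun y => ψ (y + t • v) • (‖v‖⁻¹ • v)) (hψt.smul contDiff_const)
      ((hc.comp_homeomorph (Homeomorph.addRight (t • v))).smul_right) (by
        intro x
        rw [norm_smul, norm_smul, norm_inv, norm_norm, inv_mul_cancel₀ hv'.ne', mul_one]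
        exact hb _)
    simp only [hdiv] at h
    rw [integral_const_mul, inv_mul_le_iff₀ hv'] at h
    linarith
  have := image_sub_le_mul_sub_of_deriv_le (f := fun s : ℝ => ∫ x in K, ψ (x + s • v))
    (fun t => (hd t).differentiableAt) (fun t => by rw [(hd t).deriv]; exact hbound t)
    zero_le_one
  simpa using this

theorem exists_contDiff_one_neg_one {K₁ K₂ : Set (EuclideanSpace ℝ (Fin d))}
    (h₁ : IsCompact K₁) (h₂ : IsCompact K₂) (hd : Disjoint K₁ K₂) :
    ∃ ψ : EuclideanSpace ℝ (Fin d) → ℝ, ContDiff ℝ 1 ψ ∧ HasCompactSupport ψ ∧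
      (∀ x, |ψ x| ≤ 1) ∧ (∀ x ∈ K₁, ψ x = 1) ∧ ∀ x ∈ K₂, ψ x = -1 := by
  have key : ∀ S T : Set (EuclideanSpace ℝ (Fin d)), IsCompact S → IsCompact T → Disjoint S T →
      ∃ f : EuclideanSpace ℝ (Fin d) → ℝ, ContDiff ℝ 1 f ∧ HasCompactSupport f ∧
        (∀ x, f x ∈ Icc (0 : ℝ) 1) ∧ (∀ x ∈ S, f x = 1) ∧ ∀ x ∈ T, f x = 0 := by
    intro S T hS hT hST
    obtain ⟨R, hR⟩ := hS.isBounded.subset_ball 0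
    obtain ⟨f, hf0, hf1, hf⟩ := exists_contMDiffMap_zero_one_of_isClosed
      (modelWithCornersSelf ℝ (EuclideanSpace ℝ (Fin d))) (n := 1)
      -- Vanishing off a ball as well forces compact support.
      (s := T ∪ (Metric.ball 0 R)ᶜ) (t := S)
      (hT.isClosed.union Metric.isOpen_ball.isClosed_compl) hS.isClosed
      (disjoint_union_left.2 ⟨hST.symm, disjoint_left.2 fun x hx hxS => hx (hR hxS)⟩)
    refine ⟨f, f.contMDiff.contDiff, ?_, hf, fun x hx => hf1 hx, fun x hx => hf0 (Or.inl hx)⟩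
    refine HasCompactSupport.intro (isCompact_closedBall 0 R) fun x hx => hf0 (Or.inr ?_)
    exact fun hx' => hx (Metric.ball_subset_closedBall hx')
  obtain ⟨f, hf, hfc, hfb, hf1, hf0⟩ := key K₁ K₂ h₁ h₂ hd
  obtain ⟨g, hg, hgc, hgb, hg1, hg0⟩ := key K₂ K₁ h₂ h₁ hd.symm
  refine ⟨fun x => f x - g x, hf.sub hg, hfc.sub hgc, fun x => ?_, fun x hx => ?_, fun x hx => ?_⟩
  · have := hfb x
    have := hgb x
    simp only [mem_Icc] at *
    rw [abs_le]
    constructor <;> linarith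
  · simp [hf1 x hx, hg0 x hx]
  · simp [hf0 x hx, hg1 x hx]

/-- On `S \ K` only `ψ ≥ -1` is available, so that part is lost twice. -/
theorem le_setIntegral_of_eq_one_on {S K : Set (EuclideanSpace ℝ (Fin d))}
    (hS : volume S < ∞) (hK : IsCompact K) (hKS : K ⊆ S)
    {ψ : EuclideanSpace ℝ (Fin d) → ℝ} (hi : IntegrableOn ψ S) (hb : ∀ x, |ψ x| ≤ 1)
    (h1 : ∀ x ∈ K, ψ x = 1) :
    volume.real S - 2 * volume.real (S \ K) ≤ ∫ x in S, ψ x := by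
  have hsplit := integral_inter_add_sdiff (μ := volume) hK.measurableSet hi
  rw [inter_eq_self_of_subset_right hKS] at hsplit
  have hone : ∫ x in K, ψ x = volume.real K := by
    rw [setIntegral_congr_fun hK.measurableSet (g := fun _ => (1 : ℝ)) h1]
    simp
  have hrest := norm_setIntegral_le_of_norm_le_const (μ := volume) (f := ψ) (C := 1) (s := S \ K)
    ((measure_mono sdiff_subset).trans_lt hS) (fun x _ => hb x)
  rw [one_mul, Real.norm_eq_abs, abs_le] at hrest
  have hm := measureReal_inter_add_sdiff (μ := volume) (s := S) hK.measurableSet hS.ne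
  rw [inter_eq_self_of_subset_right hKS] at hm
  linarith [hrest.1]

theorem covariogram_zero_sub_le {K : Set (EuclideanSpace ℝ (Fin d))} (hK : IsCompact K)
    (hP : perimeter K < ∞) (h : EuclideanSpace ℝ (Fin d)) :
    covariogram K 0 - covariogram K h ≤ (perimeter K).toReal / 2 * ‖h‖ := by
  have hT := hK.image_add_right h
  refine le_of_forall_pos_le_add fun ε hε => ?_
  -- Each of the two approximations costs at most `2 · ε/2`, so `2 w_K(h) ≤ Per(K)|h| + 2ε`.
  have happrox : ∀ A B : Set (EuclideanSpace ℝ (Fin d)), IsCompact A → IsCompact B →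
      ∃ C ⊆ A \ B, IsCompact C ∧ volume.real ((A \ B) \ C) < ε / 2 := by
    intro A B hA hB
    have hfin : volume (A \ B) ≠ ∞ := ((measure_mono sdiff_subset).trans_lt hA.measure_lt_top).ne
    obtain ⟨C, hC, hCc, hCε⟩ := (hA.measurableSet.diff hB.measurableSet).exists_isCompact_sdiff_lt
      hfin (ε := ENNReal.ofReal (ε / 2)) (by simpa using hε)
    exact ⟨C, hC, hCc, (ENNReal.toReal_lt_of_lt_ofReal hCε)⟩
  obtain ⟨K₁, hK₁, hK₁c, hε₁⟩ := happrox _ K hT hK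
  obtain ⟨K₂, hK₂, hK₂c, hε₂⟩ := happrox K _ hK hT
  obtain ⟨ψ, hψ, hψc, hψb, hψ1, hψ2⟩ := exists_contDiff_one_neg_one hK₁c hK₂c
    (disjoint_left.2 fun x hx hx' => (hK₁ hx).2 (hK₂ hx').1)
  have hint : ∀ S : Set (EuclideanSpace ℝ (Fin d)), IntegrableOn ψ S := fun S =>
    (hψ.continuous.integrable_of_hasCompactSupport hψc).integrableOn
  have hupper := setIntegral_comp_add_sub_le_perimeter hK hP hψ hψc hψb h
  rw [setIntegral_comp_add_sub hK hψ.continuous] at hupper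
  have hl₁ := le_setIntegral_of_eq_one_on
    ((measure_mono sdiff_subset).trans_lt hT.measure_lt_top) hK₁c hK₁ (hint _) hψb hψ1
  have hl₂ := le_setIntegral_of_eq_one_on (ψ := fun x => -ψ x)
    ((measure_mono sdiff_subset).trans_lt hK.measure_lt_top) hK₂c hK₂ (hint _).neg
    (fun x => by simpa using hψb x) (fun x hx => by simp [hψ2 x hx])
  rw [volume_real_translate_sdiff hK] at hl₁
  rw [volume_real_sdiff_translate hK, integral_neg] at hl₂
  linarith

theorem perimeter_lt_top_of_lipschitzWith {K : Set (EuclideanSpace ℝ (Fin d))}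
    (hK : IsCompact K) {C : ℝ≥0} (hC : LipschitzWith C (covariogram K)) : perimeter K < ∞ := by
  have hbound : ∀ (ψ : EuclideanSpace ℝ (Fin d) → ℝ), ContDiff ℝ 1 ψ → HasCompactSupport ψ →
      (∀ x, |ψ x| ≤ 1) → ∀ v : EuclideanSpace ℝ (Fin d),
      ∫ x in K, fderiv ℝ ψ x v ≤ 2 * C * ‖v‖ := by
    intro ψ hψ hc hb v
    have hd := hasDerivAt_setIntegral_comp_add_smul hK hψ hc v 0
    have hle := hd.le_of_lip' (C := 2 * C * ‖v‖) (by positivity)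
      (Filter.Eventually.of_forall fun t => by
        have h1 := abs_setIntegral_comp_add_sub_le hK hψ.continuous hb (t • v)
        have h2 := hC.dist_le_mul 0 (t • v)
        rw [dist_zero_left, norm_smul, Real.dist_eq] at h2
        have h3 := le_abs_self (covariogram K 0 - covariogram K (t • v))
        simp only [zero_smul, add_zero, sub_zero, Real.norm_eq_abs] at h2 ⊢
        nlinarith)
    simp only [zero_smul, add_zero] at hle
    exact (le_abs_self _).trans hle
  -- Summing over coordinates is crude, but only finiteness is needed.
  refine lt_of_le_of_lt (b := ENNReal.ofReal (∑ _i : Fin d, 2 * (C : ℝ))) ?_ ENNReal.ofReal_lt_top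
  refine iSup₂_le fun φ hφ => iSup₂_le fun hc hb => ENNReal.ofReal_le_ofReal ?_
  have hcoord : ∀ i : Fin d, ContDiff ℝ 1 (fun x => φ x i) := fun i => by fun_prop
  have hcc : ∀ i : Fin d, HasCompactSupport (fun x => φ x i) := fun i =>
    hc.comp_left (g := fun y : EuclideanSpace ℝ (Fin d) => y i) rfl
  have hf : ∀ (i : Fin d) x v, fderiv ℝ (fun y => φ y i) x v = (fderiv ℝ φ x v) i := by
    intro i x v
    have := ((EuclideanSpace.proj (𝕜 := ℝ) i).hasFDerivAt.comp x
      (hφ.differentiable one_ne_zero x).hasFDerivAt).fderiv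
    exact congrArg (fun T => T v) this
  unfold divergence
  simp only [← hf]
  rw [integral_finsetSum]
  · refine Finset.sum_le_sum fun i _ => ?_
    have := hbound _ (hcoord i) (hcc i)
      (fun x => (PiLp.norm_apply_le (φ x) i).trans (hb x)) (EuclideanSpace.single i 1)
    simpa using this
  · intro i _
    have := (hcoord i).continuous_fderiv one_ne_zero
    exact (Continuous.continuousOn (by fun_prop)).integrableOn_compact hK

theorem covariogram_zero_sub_le_nnreal {K : Set (EuclideanSpace ℝ (Fin d))} (hK : IsCompact K)
    (hP : perimeter K < ∞) (h : EuclideanSpace ℝ (Fin d)) :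
    covariogram K 0 - covariogram K h ≤ ((perimeter K / 2).toNNReal : ℝ) * ‖h‖ := by
  have := covariogram_zero_sub_le hK hP h
  rwa [ENNReal.coe_toNNReal_eq_toReal, ENNReal.toReal_div, ENNReal.toReal_ofNat]

theorem lipschitzWith_covariogram {K : Set (EuclideanSpace ℝ (Fin d))} (hK : IsCompact K)
    (hP : perimeter K < ∞) : LipschitzWith (perimeter K / 2).toNNReal (covariogram K) :=
  lipschitzWith_of_abs_add_sub_le (abs_crossCovariogram_add_sub_le_right K hK)
    (covariogram_zero_sub_le_nnreal hK hP)

theorem lipschitzWith_crossCovariogram {D L : Set (EuclideanSpace ℝ (Fin d))}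
    (hD : IsCompact D) (hL : IsCompact L) (hP : perimeter D < ∞ ∨ perimeter L < ∞) :
    LipschitzWith (min (perimeter D) (perimeter L)).toNNReal (crossCovariogram D L) := by
  have key : ∀ K : Set (EuclideanSpace ℝ (Fin d)), IsCompact K → perimeter K < ∞ → ∀ h,
      covariogram K 0 - covariogram K h ≤ ((perimeter K).toNNReal : ℝ) * ‖h‖ := by
    intro K hK hPK h
    refine (covariogram_zero_sub_le hK hPK h).trans ?_
    rw [ENNReal.coe_toNNReal_eq_toReal]
    gcongr
    exact half_le_self ENNReal.toReal_nonneg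
  rcases le_total (perimeter D) (perimeter L) with hle | hle
  · rw [min_eq_left hle]
    have hPD : perimeter D < ∞ := hP.elim id hle.trans_lt
    exact lipschitzWith_of_abs_add_sub_le (abs_crossCovariogram_add_sub_le_left hD L)
      (key D hD hPD)
  · rw [min_eq_right hle]
    have hPL : perimeter L < ∞ := hP.elim hle.trans_lt id
    exact lipschitzWith_of_abs_add_sub_le (abs_crossCovariogram_add_sub_le_right D hL)
      (key L hL hPL)

end Perimeter

/-! ### Lipschitz functions on a line -/

section Ray

variable {E : Type*} [NormedAddCommGroup E] [NormedSpace ℝ E]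

theorem LipschitzWith.comp_smul_unit {g : E → ℝ} {C : ℝ≥0} (hg : LipschitzWith C g) {θ : E}
    (hθ : ‖θ‖ = 1) : LipschitzWith C (fun s : ℝ => g (s • θ)) := by
  refine LipschitzWith.of_dist_le_mul fun x y => ?_
  have := hg.dist_le_mul (x • θ) (y • θ)
  rwa [dist_eq_norm (x • θ), ← sub_smul, norm_smul, hθ, mul_one, ← dist_eq_norm] at this

theorem LipschitzWith.integrableOn_deriv_Ioi {f : ℝ → ℝ} {C : ℝ≥0} (hf : LipschitzWith C f)
    {R : ℝ} (hR : ∀ r, R < r → f r = 0) (a : ℝ) : IntegrableOn (deriv f) (Ioi a) := by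
  have hzero : ∀ r ∈ Ioi R, deriv f r = 0 := by
    intro r hr
    have : f =ᶠ[nhds r] fun _ => 0 := by
      filter_upwards [Ioi_mem_nhds hr] with s hs using hR s hs
    rw [this.deriv_eq, deriv_const]
  have hbdd : IntegrableOn (deriv f) (Ioc a R) := by
    refine IntegrableOn.of_bound measure_Ioc_lt_top
      (measurable_deriv f).aestronglyMeasurable C (Filter.Eventually.of_forall fun x => ?_)
    exact norm_deriv_le_of_lipschitz hf
  have htail : IntegrableOn (deriv f) (Ioi R) :=
    integrableOn_zero.congr_fun (fun r hr => (hzero r hr).symm) measurableSet_Ioi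
  exact (hbdd.union htail).mono_set fun x hx => (le_or_gt x R).imp (fun h => ⟨hx, h⟩) id

theorem LipschitzWith.eq_intervalIntegral_neg_deriv {f : ℝ → ℝ} {C : ℝ≥0}
    (hf : LipschitzWith C f) {R : ℝ} (hR : ∀ r, R < r → f r = 0) (r : ℝ) :
    f r = ∫ l in r..R, -deriv f l := by
  -- `hR` is strict, so the value at `R` comes from continuity.
  have hfR : f R = 0 := by
    have h1 : Filter.Tendsto f (nhdsWithin R (Ioi R)) (nhds (f R)) :=
      hf.continuous.continuousAt.mono_left nhdsWithin_le_nhds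
    have h2 : Filter.Tendsto f (nhdsWithin R (Ioi R)) (nhds 0) :=
      tendsto_const_nhds.congr' (by
        filter_upwards [self_mem_nhdsWithin] with s hs using (hR s hs).symm)
    exact tendsto_nhds_unique h1 h2
  rw [intervalIntegral.integral_neg,
    (hf.lipschitzOnWith (s := uIcc r R)).absolutelyContinuousOnInterval.integral_deriv_eq_sub,
    hfR]
  ring

end Ray

theorem proposition2p1 (d : ℕ) (hd : 1 ≤ d) (D L : Set (EuclideanSpace ℝ (Fin d)))
    (hD : IsCompact D) (hL : IsCompact L) :
    -- (i)
    ((∀ z, crossCovariogram D L z = crossCovariogram L D (-z)) ∧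
      (∀ z, covariogram D z = covariogram D (-z))) ∧
    -- (ii)
    (∀ z h, |crossCovariogram D L (z + h) - crossCovariogram D L z| ≤
      2 * min (covariogram D 0 - covariogram D h) (covariogram L 0 - covariogram L h)) ∧
    -- (iii)
    (∀ z, diffRadius D L < ‖z‖ → crossCovariogram D L z = 0) ∧
    -- (iv)
    ((perimeter D < ∞ ↔ ∃ C : ℝ≥0, LipschitzWith C (covariogram D)) ∧
      (perimeter D < ∞ → LipschitzWith (perimeter D / 2).toNNReal (covariogram D))) ∧
    -- (v)
    (perimeter D < ∞ ∨ perimeter L < ∞ →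
      LipschitzWith (min (perimeter D) (perimeter L)).toNNReal (crossCovariogram D L) ∧
      (∀ᵐ z, ∀ θ : EuclideanSpace ℝ (Fin d), ‖θ‖ = 1 →
        LineDifferentiableAt ℝ (crossCovariogram D L) z θ ∧
        |lineDeriv ℝ (crossCovariogram D L) z θ| ≤
          (min (perimeter D) (perimeter L)).toReal) ∧
      (∀ θ : EuclideanSpace ℝ (Fin d), ‖θ‖ = 1 →
        (∀ᵐ l : ℝ, DifferentiableAt ℝ (fun s : ℝ => crossCovariogram D L (s • θ)) l ∧
          |deriv (fun s : ℝ => crossCovariogram D L (s • θ)) l| ≤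
            (min (perimeter D) (perimeter L)).toReal) ∧
        (∀ a b : ℝ,
          AbsolutelyContinuousOnInterval (fun s : ℝ => crossCovariogram D L (s • θ)) a b) ∧
        IntegrableOn (deriv (fun s : ℝ => crossCovariogram D L (s • θ))) (Ioi 0) ∧
        (∀ r : ℝ, 0 < r →
          crossCovariogram D L (r • θ) =
            ∫ l in r..diffRadius D L,
              -deriv (fun s : ℝ => crossCovariogram D L (s • θ)) l))) := by
  have hlip := lipschitzWith_crossCovariogram hD hL
  refine ⟨⟨crossCovariogram_neg D L, fun z => (covariogram_neg D z).symm⟩, fun z h => ?_,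
    fun z hz => crossCovariogram_eq_zero_of_diffRadius_lt hD hL hz,
    ⟨⟨fun hP => ⟨_, lipschitzWith_covariogram hD hP⟩,
      fun ⟨_, hC⟩ => perimeter_lt_top_of_lipschitzWith hD hC⟩, lipschitzWith_covariogram hD⟩,
    fun hP => ⟨hlip hP, ?_, fun θ hθ => ?_⟩⟩
  · have h1 := abs_crossCovariogram_add_sub_le_left hD L z h
    have h2 := abs_crossCovariogram_add_sub_le_right D hL z h
    have h3 := le_min h1 h2
    -- The bound holds without the factor 2; inserting it requires the minimum to be nonnegative.
    have h4 := abs_nonneg (crossCovariogram D L (z + h) - crossCovariogram D L z)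
    linarith
  -- Full differentiability gives one null set that serves all directions.
  · filter_upwards [(hlip hP).ae_differentiableAt] with z hz θ hθ
    refine ⟨hz.lineDifferentiableAt, ?_⟩
    have := norm_lineDeriv_le_of_lipschitz ℝ (v := θ) (x₀ := z) (hlip hP)
    rwa [hθ, mul_one, ENNReal.coe_toNNReal_eq_toReal] at this
  · have hray := (hlip hP).comp_smul_unit hθ
    have hR : ∀ r, diffRadius D L < r → crossCovariogram D L (r • θ) = 0 := fun r hr =>
      crossCovariogram_eq_zero_of_diffRadius_lt hD hL (by
        rw [norm_smul, hθ, mul_one]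
        exact hr.trans_le (le_abs_self r))
    refine ⟨?_, fun a b => hray.lipschitzOnWith.absolutelyContinuousOnInterval,
      hray.integrableOn_deriv_Ioi hR 0, fun r _ => hray.eq_intervalIntegral_neg_deriv hR r⟩
    filter_upwards [hray.ae_differentiableAt_real] with l hl
    refine ⟨hl, ?_⟩
    have := norm_deriv_le_of_lipschitz (x₀ := l) hray
    rwa [ENNReal.coe_toNNReal_eq_toReal] at this
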